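/- Theorem [Equidistribution of (tr, vol) and (cor, ch-vol) for plane partitions]. A plane partition is an array $\pi=(\pi_{i,j})_{i,j\ge 1}$ of nonnegative integers with finitely many nonzero entries such that $\pi_{i,j}\ge\pi_{i',j'}$ whenever $i\le i'$ and $j\le j'$. Its diagram is $D(\pi)=\{(i,j,k)\in\mathbb{Z}_{>0}^3 : k\le\pi_{i,j}\}$, its volume is $|\pi|=\sum_{i,j}\pi_{i,j}$, and its trace is $\mathrm{tr}(\pi)=\sum_i\pi_{i,i}$. Its set of corners is $$\mathrm{Cor}(\pi)=\{(i,j,k)\in D(\pi) : (i+1,j,k)\notin D(\pi),\ (i,j+1,k)\notin D(\pi)\},$$ and we put $\mathrm{cor}(\pi)=|\mathrm{Cor}(\pi)|$ and $|\pi|_{ch}=\sum_{(i,j,k)\in\mathrm{Cor}(\pi)}(i+j-1)$ (the corner-hook volume). For nonnegative integers $n_1,n_2$, let $\mathcal{P}(n_1,n_2,\infty)$ be the set of plane partitions $\pi$ with $D(\pi)\subseteq\{1,\dots,n_1\}\times\{1,\dots,n_2\}\times\mathbb{Z}_{>0}$. Then, as well-defined formal power series in $t$ and $q$, $$\sum_{\pi\in\mathcal{P}(n_1,n_2,\infty)}t^{\mathrm{cor}(\pi)}q^{|\pi|_{ch}}=\sum_{\pi\in\mathcal{P}(n_1,n_2,\infty)}t^{\mathrm{tr}(\pi)}q^{|\pi|}.$$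 Equivalently, for all integers $a,b\ge 0$, the sets $\{\pi\in\mathcal{P}(n_1,n_2,\infty) : \mathrm{cor}(\pi)=a,\ |\pi|_{ch}=b\}$ and $\{\pi\in\mathcal{P}(n_1,n_2,\infty) : \mathrm{tr}(\pi)=a,\ |\pi|=b\}$ are finite and have the same number of elements. -/

import Mathlib

open scoped MvPowerSeries.WithPiTopology

/-- A plane partition: an array `(π_{i,j})_{i,j ≥ 1}` of nonnegative integers with finitely many
nonzero entries, weakly decreasing for the componentwise order on `ℕ+ × ℕ+`. -/
@[ext]
structure PlanePartition where
  entry : ℕ+ × ℕ+ → ℕ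
  finite_support : entry.support.Finite
  antitone_entry : Antitone entry

namespace PlanePartition

/-- The diagram `D(π) = {(i, j, k) : 1 ≤ k ≤ π_{i,j}}`. -/
def diagram (π : PlanePartition) : Set (ℕ+ × ℕ+ × ℕ+) :=
  {c | (c.2.2 : ℕ) ≤ π.entry (c.1, c.2.1)}

/-- The corners: the `(i, j, k) ∈ D(π)` such that `(i+1, j, k)` and `(i, j+1, k)` are not
in `D(π)`. -/
def Cor (π : PlanePartition) : Set (ℕ+ × ℕ+ × ℕ+) :=
  {c | c ∈ π.diagram ∧ (c.1 + 1, c.2.1, c.2.2) ∉ π.diagram ∧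
    (c.1, c.2.1 + 1, c.2.2) ∉ π.diagram}

theorem finite_diagram (π : PlanePartition) : π.diagram.Finite := by
  have h : (⋃ p ∈ π.entry.support,
      (fun k : ℕ+ => (p.1, p.2, k)) '' {k : ℕ+ | (k : ℕ) ≤ π.entry p}).Finite := by
    refine π.finite_support.biUnion fun p _ => Set.Finite.image _ ?_
    exact Set.Finite.preimage (f := fun k : ℕ+ => (k : ℕ)) (PNat.coe_injective.injOn)
      (Set.finite_Iic (π.entry p))
  refine h.subset ?_
  rintro ⟨i, j, k⟩ hk
  have hk' : (k : ℕ) ≤ π.entry (i, j) := hk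
  have hpos := k.pos
  simp only [Set.mem_iUnion]
  exact ⟨(i, j), by rw [Function.mem_support]; omega, k, hk', rfl⟩

theorem finite_Cor (π : PlanePartition) : π.Cor.Finite :=
  π.finite_diagram.subset fun _ h => h.1

/-- The number of corners. -/
noncomputable def cor (π : PlanePartition) : ℕ := π.Cor.ncard

/-- The corner-hook volume `|π|_ch`: the sum over the corners `(i, j, k)` of the cohook length
`i + j - 1`. -/
noncomputable def cornerHookVolume (π : PlanePartition) : ℕ :=
  ∑ c ∈ π.finite_Cor.toFinset, ((c.1 : ℕ) + (c.2.1 : ℕ) - 1)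

/-- The volume `|π|`: the sum of all entries. -/
noncomputable def volume (π : PlanePartition) : ℕ :=
  ∑ p ∈ π.finite_support.toFinset, π.entry p

/-- The trace: the sum of the diagonal entries `π_{i,i}`. -/
noncomputable def trace (π : PlanePartition) : ℕ := ∑ᶠ i : ℕ+, π.entry (i, i)

/-- The set `P(n₁, n₂, ∞)` of plane partitions whose diagram lies in `[n₁] × [n₂] × ℤ₊`. -/
def boxed (n₁ n₂ : ℕ) : Set PlanePartition :=
  {π | ∀ c ∈ π.diagram, (c.1 : ℕ) ≤ n₁ ∧ (c.2.1 : ℕ) ≤ n₂}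

end PlanePartition

/-- The monomial `t ^ a * q ^ b` in the ring `ℤ⟦t, q⟧` of formal power series, where `t` and `q`
are the variables with index `0` and `1`. The topology on `ℤ⟦t, q⟧` is that of coefficientwise
convergence. -/
noncomputable def tqMonomial (a b : ℕ) : MvPowerSeries (Fin 2) ℤ :=
  MvPowerSeries.X 0 ^ a * MvPowerSeries.X 1 ^ b

/-! Both sides are encoded by nonnegative integer matrices `x` supported in `n₁ × n₂`, with `x a b`
weighted by `t` and by `q` to the power `(n₁ - a) + (n₂ - b) - 1`.

For the corner side, `cornerCount` records how many corners lie above each cell. Up to reversing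
both indices this is `x`, and the partition is recovered from the last passage recursion `G =
max(G', G'') + x` (`cornerEquiv`). So `cor` is the sum of `x`, and the cohook length of a cell is
the stated weight.

For the trace side, RSK is run through local growth rules (`growthEquiv`). The sequences at `(n₁ -
d, n₂)` and `(n₁, n₂ - d)` become the diagonals of a plane partition. By `sum_growth` each diagonal
sums to the total of `x` over a subrectangle: the main diagonal gives the trace as the sum of `x`,
and counting the subrectangles containing `(a, b)` gives the weight again (`volume_growthArray`).

Composing the two bijections transports one pair of statistics to the other. -/

/-! ### Local growth rule for interlacing sequences -/

/-- The sequence `α` interlaces `β` from below: `β₀ ≥ α₀ ≥ β₁ ≥ α₁ ≥ ⋯`. -/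
def Interlace (α β : ℕ → ℕ) : Prop := ∀ k, α k ≤ β k ∧ β (k + 1) ≤ α k

/-- The local rule of the Robinson–Schensted–Knuth correspondence. -/
def growUp (μ α β : ℕ → ℕ) (m : ℕ) : ℕ → ℕ
  | 0 => max (α 0) (β 0) + m
  | k + 1 => max (α (k + 1)) (β (k + 1)) + min (α k) (β k) - μ k

/-- The inverse local rule. -/
def growDown (α β ν : ℕ → ℕ) (k : ℕ) : ℕ :=
  max (α (k + 1)) (β (k + 1)) + min (α k) (β k) - ν (k + 1)

/-- Interlacing puts `μ k` in the interval from `max (α (k+1)) (β (k+1))` to `min (α k) (β k)`, and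
the rule reflects it there. Hence the truncated subtraction is exact and the new value obeys the
same bounds. -/
theorem Interlace.growUp_left {μ α β : ℕ → ℕ} (hα : Interlace μ α) (hβ : Interlace μ β) (m : ℕ) :
    Interlace α (growUp μ α β m) := by
  intro k
  have h1 := hα k
  have h2 := hβ k
  refine ⟨?_, by simp only [growUp]; omega⟩
  cases k with
  | zero => simp only [growUp]; omega
  | succ k =>
    have h3 := hα k
    have h4 := hβ k
    simp only [growUp]; omega

theorem growUp_comm (μ α β : ℕ → ℕ) (m : ℕ) : growUp μ α β m = growUp μ β α m := by
  funext k
  cases k <;> simp only [growUp, max_comm, min_comm]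

theorem Interlace.growUp_right {μ α β : ℕ → ℕ} (hα : Interlace μ α) (hβ : Interlace μ β) (m : ℕ) :
    Interlace β (growUp μ α β m) :=
  growUp_comm μ β α m ▸ hβ.growUp_left hα m

/-- Now `ν (k + 1)` lies in that same interval, and is reflected back. -/
theorem Interlace.growDown_left {α β ν : ℕ → ℕ} (hα : Interlace α ν) (hβ : Interlace β ν) :
    Interlace (growDown α β ν) α := by
  intro k
  have h1 := hα k
  have h2 := hβ k
  have h3 := hα (k + 1)
  have h4 := hβ (k + 1)
  simp only [growDown]
  omega

theorem growDown_comm (α β ν : ℕ → ℕ) : growDown α β ν = growDown β α ν := by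
  funext k
  simp only [growDown, max_comm, min_comm]

theorem Interlace.growDown_right {α β ν : ℕ → ℕ} (hα : Interlace α ν) (hβ : Interlace β ν) :
    Interlace (growDown α β ν) β :=
  growDown_comm β α ν ▸ hβ.growDown_left hα

theorem growDown_growUp {μ α β : ℕ → ℕ} (hα : Interlace μ α) (hβ : Interlace μ β) (m : ℕ) :
    growDown α β (growUp μ α β m) = μ := by
  funext k
  have h1 := hα k
  have h2 := hβ k
  simp only [growDown, growUp]
  omega

theorem growUp_growDown {α β ν : ℕ → ℕ} (hα : Interlace α ν) (hβ : Interlace β ν) :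
    growUp (growDown α β ν) α β (ν 0 - max (α 0) (β 0)) = ν := by
  funext k
  cases k with
  | zero =>
    have h1 := hα 0
    have h2 := hβ 0
    simp only [growUp]
    omega
  | succ k =>
    have h1 := hα k
    have h2 := hβ k
    have h3 := hα (k + 1)
    have h4 := hβ (k + 1)
    simp only [growUp, growDown]
    omega

/-- Since `max + min` is the sum, the rule conserves total size up to `m`. The term `min (α N) (β
N)` is the half not yet paired at the cutoff; it vanishes once `N` is past the support. -/
theorem sum_growUp {μ α β : ℕ → ℕ} (hα : Interlace μ α) (hβ : Interlace μ β) (m N : ℕ) :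
    ∑ k ∈ Finset.range (N + 1), growUp μ α β m k + ∑ k ∈ Finset.range N, μ k + min (α N) (β N) =
      ∑ k ∈ Finset.range (N + 1), α k + ∑ k ∈ Finset.range (N + 1), β k + m := by
  induction N with
  | zero => simp [growUp]; omega
  | succ N ih =>
    have h1 := hα N
    have h2 := hβ N
    rw [Finset.sum_range_succ _ (N + 1), Finset.sum_range_succ μ N,
      Finset.sum_range_succ α (N + 1), Finset.sum_range_succ β (N + 1)]
    have h3 : growUp μ α β m (N + 1) =
      max (α (N + 1)) (β (N + 1)) + min (α N) (β N) - μ N := rfl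
    omega

/-! ### Growth diagrams -/

/-- The growth diagram of a matrix `x`, a sequence at each lattice point `(i, j)`. -/
def growth (x : ℕ → ℕ → ℕ) : ℕ → ℕ → ℕ → ℕ
  | 0, _ => fun _ => 0
  | _ + 1, 0 => fun _ => 0
  | i + 1, j + 1 =>
    growUp (growth x i j) (growth x i (j + 1)) (growth x (i + 1) j) (x i j)

theorem growth_zero_left (x : ℕ → ℕ → ℕ) (j : ℕ) : growth x 0 j = fun _ => 0 := by
  rw [growth]

theorem growth_zero_right (x : ℕ → ℕ → ℕ) (i : ℕ) : growth x i 0 = fun _ => 0 := by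
  cases i <;> rw [growth]

theorem growth_succ_succ (x : ℕ → ℕ → ℕ) (i j : ℕ) : growth x (i + 1) (j + 1) =
    growUp (growth x i j) (growth x i (j + 1)) (growth x (i + 1) j) (x i j) := by
  rw [growth]

/-- The two directions feed each other: horizontal interlacing in row `i` gives the vertical one
from `i` to `i + 1`, which gives the horizontal one in row `i + 1`. -/
theorem interlace_growth (x : ℕ → ℕ → ℕ) (i j : ℕ) :
    Interlace (growth x i j) (growth x i (j + 1)) ∧
      Interlace (growth x i j) (growth x (i + 1) j) := by
  have key : ∀ i, (∀ j, Interlace (growth x i j) (growth x i (j + 1))) →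
      ∀ j, Interlace (growth x i j) (growth x (i + 1) j) := by
    intro i h j
    induction j with
    | zero => simp [growth_zero_right, Interlace]
    | succ j ih => rw [growth_succ_succ]; exact (h j).growUp_left ih _
  have row : ∀ i j, Interlace (growth x i j) (growth x i (j + 1)) := by
    intro i
    induction i with
    | zero => intro j; simp [growth_zero_left, Interlace]
    | succ i ih => intro j; rw [growth_succ_succ]; exact (ih j).growUp_right (key i ih j) _
  exact ⟨row i j, key i (row i) j⟩

theorem growth_eq_zero (x : ℕ → ℕ → ℕ) (i j k : ℕ) (h : i ≤ k ∨ j ≤ k) : growth x i j k = 0 := by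
  have hi : ∀ i k, i ≤ k → growth x i j k = 0 := by
    intro i
    induction i with
    | zero => intro k _; rw [growth_zero_left]
    | succ i ih =>
      intro k hk
      obtain ⟨k, rfl⟩ : ∃ l, k = l + 1 := ⟨k - 1, by omega⟩
      have h1 := ((interlace_growth x i j).2 k).2
      have h2 := ih k (by omega)
      omega
  have hj : ∀ j k, j ≤ k → growth x i j k = 0 := by
    intro j
    induction j with
    | zero => intro k _; rw [growth_zero_right]
    | succ j ih =>
      intro k hk
      obtain ⟨k, rfl⟩ : ∃ l, k = l + 1 := ⟨k - 1, by omega⟩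
      have h1 := ((interlace_growth x i j).1 k).2
      have h2 := ih k (by omega)
      omega
  exact h.elim (hi i k) (hj j k)

theorem sum_growth (x : ℕ → ℕ → ℕ) (i j N : ℕ) (h : i ≤ N) :
    ∑ k ∈ Finset.range N, growth x i j k =
      ∑ a ∈ Finset.range i, ∑ b ∈ Finset.range j, x a b := by
  revert h N
  induction i generalizing j with
  | zero => intro N _; simp [growth_zero_left]
  | succ i ihi =>
    induction j with
    | zero => intro N _; simp [growth_zero_right]
    | succ j ihj =>
      -- The extra term makes `sum_growUp` at `N` apply with vanishing `min`; it is zero itself and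
      -- is dropped at the end. What remains is inclusion–exclusion over rectangles.
      have big : ∀ N, i + 1 ≤ N → ∑ k ∈ Finset.range (N + 1), growth x (i + 1) (j + 1) k =
          ∑ a ∈ Finset.range (i + 1), ∑ b ∈ Finset.range (j + 1), x a b := by
        intro N hN
        have h1 := sum_growUp (interlace_growth x i j).1 (interlace_growth x i j).2 (x i j) N
        rw [← growth_succ_succ, ihi j N (by omega), ihi (j + 1) (N + 1) (by omega),
          ihj (N + 1) (by omega), growth_eq_zero x i (j + 1) N (by omega)] at h1
        simp only [Finset.sum_range_succ, Finset.sum_add_distrib] at h1 ⊢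
        omega
      intro N hN
      have h2 := big N hN
      rw [Finset.sum_range_succ, growth_eq_zero x _ _ N (by omega)] at h2
      omega

/-! ### Inverse growth, with `(a, b)` measuring the distance back from the corner `(n₁, n₂)`. -/

/-- The matrix of growth-diagram sequences read backwards from the diagonals of an array. -/
def shrink (e : ℕ → ℕ → ℕ) : ℕ → ℕ → ℕ → ℕ
  | a, 0 => fun k => e (k + a) k
  | 0, b + 1 => fun k => e k (k + (b + 1))
  | a + 1, b + 1 => growDown (shrink e a (b + 1)) (shrink e (a + 1) b) (shrink e a b)

theorem shrink_zero_right (e : ℕ → ℕ → ℕ) (a : ℕ) : shrink e a 0 = fun k => e (k + a) k := by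
  cases a <;> rw [shrink]

theorem shrink_zero_left (e : ℕ → ℕ → ℕ) (b : ℕ) : shrink e 0 b = fun k => e k (k + b) := by
  cases b with
  | zero => rw [shrink]; rfl
  | succ b => rw [shrink]

theorem shrink_succ_succ (e : ℕ → ℕ → ℕ) (a b : ℕ) : shrink e (a + 1) (b + 1) =
    growDown (shrink e a (b + 1)) (shrink e (a + 1) b) (shrink e a b) := by
  rw [shrink]

/-- An array that is weakly decreasing along rows and columns. -/
def Decreasing (e : ℕ → ℕ → ℕ) : Prop := ∀ r s, e (r + 1) s ≤ e r s ∧ e r (s + 1) ≤ e r s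

/-- On the boundary, interlacing of adjacent diagonals is exactly monotonicity of `e` along rows and
columns; the inverse rule carries it inwards. -/
theorem Decreasing.interlace_shrink {e : ℕ → ℕ → ℕ} (he : Decreasing e) (a b : ℕ) :
    Interlace (shrink e a (b + 1)) (shrink e a b) ∧
      Interlace (shrink e (a + 1) b) (shrink e a b) := by
  have col0 : ∀ a, Interlace (shrink e (a + 1) 0) (shrink e a 0) := by
    intro a k
    simp only [shrink_zero_right]
    have h1 := (he (k + a) k).1
    have h2 := (he (k + a + 1) k).2
    rw [show k + 1 + a = k + a + 1 by ring, ← add_assoc]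
    exact ⟨h1, h2⟩
  have row0 : ∀ b, Interlace (shrink e 0 (b + 1)) (shrink e 0 b) := by
    intro b k
    simp only [shrink_zero_left]
    have h1 := (he k (k + b)).2
    have h2 := (he k (k + b + 1)).1
    rw [show k + 1 + b = k + b + 1 by ring, ← add_assoc]
    exact ⟨h1, h2⟩
  have key : ∀ a, (∀ b, Interlace (shrink e a (b + 1)) (shrink e a b)) →
      ∀ b, Interlace (shrink e (a + 1) b) (shrink e a b) := by
    intro a h b
    induction b with
    | zero => exact col0 a
    | succ b ih => rw [shrink_succ_succ]; exact (h b).growDown_left ih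
  have row : ∀ a b, Interlace (shrink e a (b + 1)) (shrink e a b) := by
    intro a
    induction a with
    | zero => exact row0
    | succ a ih => intro b; rw [shrink_succ_succ]; exact (ih b).growDown_right (key a ih b)
  exact ⟨row a b, key a (row a) b⟩

theorem shrink_diag (e : ℕ → ℕ → ℕ) (r s : ℕ) : shrink e (r - s) (s - r) (min r s) = e r s := by
  rcases le_total r s with h | h
  · rw [Nat.sub_eq_zero_of_le h, shrink_zero_left, min_eq_left h]
    simp only [Nat.add_sub_cancel' h]
  · rw [Nat.sub_eq_zero_of_le h, shrink_zero_right, min_eq_right h]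
    simp only [Nat.add_sub_cancel' h]

/-- An array vanishing outside `[0, n₁) × [0, n₂)`. -/
def SupportedIn (n₁ n₂ : ℕ) (e : ℕ → ℕ → ℕ) : Prop := ∀ r s, n₁ ≤ r ∨ n₂ ≤ s → e r s = 0

theorem shrink_eq_zero {n₁ n₂ : ℕ} {e : ℕ → ℕ → ℕ} (he : Decreasing e)
    (hs : SupportedIn n₁ n₂ e) (a b : ℕ) (h : n₁ ≤ a ∨ n₂ ≤ b) : shrink e a b = fun _ => 0 := by
  funext k
  rcases h with h | h
  · induction b with
    | zero => rw [shrink_zero_right]; exact hs _ _ (by omega)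
    | succ b ih => have := ((he.interlace_shrink a b).1 k).1; omega
  · induction a with
    | zero => rw [shrink_zero_left]; exact hs _ _ (by omega)
    | succ a ih => have := ((he.interlace_shrink a b).2 k).1; omega

/-! ### RSK between matrices and arrays. -/

/-- The array whose diagonals are the sequences on the boundary of the growth diagram of `x`. -/
def growthArray (n₁ n₂ : ℕ) (x : ℕ → ℕ → ℕ) (r s : ℕ) : ℕ :=
  growth x (n₁ - (r - s)) (n₂ - (s - r)) (min r s)

/-- The inverse of `growthArray`. -/
def shrinkMatrix (n₁ n₂ : ℕ) (e : ℕ → ℕ → ℕ) (i j : ℕ) : ℕ :=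
  if i < n₁ ∧ j < n₂ then
    shrink e (n₁ - (i + 1)) (n₂ - (j + 1)) 0 -
      max (shrink e (n₁ - i) (n₂ - (j + 1)) 0) (shrink e (n₁ - (i + 1)) (n₂ - j) 0)
  else 0

theorem growthArray_supportedIn (n₁ n₂ : ℕ) (x : ℕ → ℕ → ℕ) :
    SupportedIn n₁ n₂ (growthArray n₁ n₂ x) := fun r s h =>
  growth_eq_zero _ _ _ _ (by omega)

/-- A unit step away from the main diagonal keeps `min r s` and moves one place back along the
boundary; a step towards it raises `min r s` and moves one place forward. These are the two halves
of interlacing. -/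
theorem growthArray_decreasing (n₁ n₂ : ℕ) (x : ℕ → ℕ → ℕ) :
    Decreasing (growthArray n₁ n₂ x) := by
  intro r s
  have left : ∀ i j k, growth x (i - 1) j k ≤ growth x i j k := by
    intro i j k
    cases i with
    | zero => simp
    | succ i => exact ((interlace_growth x i j).2 k).1
  have left' : ∀ i j k, growth x i j (k + 1) ≤ growth x (i - 1) j k := by
    intro i j k
    cases i with
    | zero => simp [growth_zero_left]
    | succ i => exact ((interlace_growth x i j).2 k).2
  have right : ∀ i j k, growth x i (j - 1) k ≤ growth x i j k := by
    intro i j k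
    cases j with
    | zero => simp
    | succ j => exact ((interlace_growth x i j).1 k).1
  have right' : ∀ i j k, growth x i j (k + 1) ≤ growth x i (j - 1) k := by
    intro i j k
    cases j with
    | zero => simp [growth_zero_right]
    | succ j => exact ((interlace_growth x i j).1 k).2
  unfold growthArray
  constructor
  · by_cases h : s ≤ r
    · convert left (n₁ - (r - s)) (n₂ - (s - r)) (min r s) using 2 <;> omega
    · convert right' (n₁ - (r - s)) (n₂ - (s - (r + 1))) (min r s) using 2 <;> omega
  · by_cases h : r ≤ s
    · convert right (n₁ - (r - s)) (n₂ - (s - r)) (min r s) using 2 <;> omega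
    · convert left' (n₁ - (r - (s + 1))) (n₂ - (s - r)) (min r s) using 2 <;> omega

theorem growth_shrinkMatrix {n₁ n₂ : ℕ} {e : ℕ → ℕ → ℕ} (he : Decreasing e)
    (hs : SupportedIn n₁ n₂ e) (i j : ℕ) (hi : i ≤ n₁) (hj : j ≤ n₂) :
    growth (shrinkMatrix n₁ n₂ e) i j = shrink e (n₁ - i) (n₂ - j) := by
  induction i generalizing j with
  | zero => rw [growth_zero_left, shrink_eq_zero he hs _ _ (by omega)]
  | succ i ihi =>
    induction j with
    | zero => rw [growth_zero_right, shrink_eq_zero he hs _ _ (by omega)]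
    | succ j ihj =>
      obtain ⟨a, rfl⟩ := Nat.exists_eq_add_of_le hi
      obtain ⟨b, rfl⟩ := Nat.exists_eq_add_of_le hj
      rw [growth_succ_succ, ihi j (by omega) (by omega), ihi (j + 1) (by omega) hj,
        ihj (by omega), shrinkMatrix, if_pos (by omega)]
      have h1 : i + 1 + a - i = a + 1 := by omega
      have h2 : j + 1 + b - j = b + 1 := by omega
      rw [h1, h2, Nat.add_sub_cancel_left, Nat.add_sub_cancel_left, shrink_succ_succ,
        growDown_comm]
      exact growUp_growDown (he.interlace_shrink a b).2 (he.interlace_shrink a b).1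

theorem growthArray_shrinkMatrix {n₁ n₂ : ℕ} {e : ℕ → ℕ → ℕ} (he : Decreasing e)
    (hs : SupportedIn n₁ n₂ e) : growthArray n₁ n₂ (shrinkMatrix n₁ n₂ e) = e := by
  funext r s
  rw [growthArray, growth_shrinkMatrix he hs _ _ (by omega) (by omega)]
  by_cases h : r - s ≤ n₁ ∧ s - r ≤ n₂
  · rw [Nat.sub_sub_self h.1, Nat.sub_sub_self h.2, shrink_diag]
  · rw [shrink_eq_zero he hs _ _ (by omega), hs r s (by omega)]

theorem shrink_growthArray (n₁ n₂ : ℕ) (x : ℕ → ℕ → ℕ) (a b : ℕ) (ha : a ≤ n₁) (hb : b ≤ n₂) :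
    shrink (growthArray n₁ n₂ x) a b = growth x (n₁ - a) (n₂ - b) := by
  induction a generalizing b with
  | zero =>
    rw [shrink_zero_left]
    funext k
    simp [growthArray]
  | succ a iha =>
    induction b with
    | zero =>
      rw [shrink_zero_right]
      funext k
      simp [growthArray]
    | succ b ihb =>
      rw [shrink_succ_succ, iha b (by omega) (by omega), iha (b + 1) (by omega) hb,
        ihb (by omega)]
      obtain ⟨i, rfl⟩ := Nat.exists_eq_add_of_le ha
      obtain ⟨j, rfl⟩ := Nat.exists_eq_add_of_le hb
      have h1 : a + 1 + i - a = i + 1 := by omega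
      have h2 : b + 1 + j - b = j + 1 := by omega
      rw [h1, h2, Nat.add_sub_cancel_left, Nat.add_sub_cancel_left, growth_succ_succ,
        growUp_comm]
      rw [growUp_comm, growDown_comm]
      exact growDown_growUp (interlace_growth x i j).1 (interlace_growth x i j).2 _

theorem shrinkMatrix_growthArray {n₁ n₂ : ℕ} {x : ℕ → ℕ → ℕ} (hx : SupportedIn n₁ n₂ x) :
    shrinkMatrix n₁ n₂ (growthArray n₁ n₂ x) = x := by
  funext i j
  unfold shrinkMatrix
  split_ifs with h
  · simp only [shrink_growthArray n₁ n₂ x _ _ (Nat.sub_le _ _) (Nat.sub_le _ _)]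
    rw [Nat.sub_sub_self h.1, Nat.sub_sub_self h.2, Nat.sub_sub_self h.1.le,
      Nat.sub_sub_self h.2.le, growth_succ_succ]
    simp only [growUp, Nat.succ_eq_add_one]
    omega
  · exact (hx i j (by omega)).symm

theorem shrinkMatrix_supportedIn (n₁ n₂ : ℕ) (e : ℕ → ℕ → ℕ) :
    SupportedIn n₁ n₂ (shrinkMatrix n₁ n₂ e) := fun _ _ h => if_neg (by omega)

/-! ### Trace and volume under RSK. -/

theorem trace_growthArray (n₁ n₂ N : ℕ) (hN : n₁ ≤ N) (x : ℕ → ℕ → ℕ) :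
    ∑ k ∈ Finset.range N, growthArray n₁ n₂ x k k =
      ∑ a ∈ Finset.range n₁, ∑ b ∈ Finset.range n₂, x a b := by
  rw [← sum_growth x n₁ n₂ N hN]
  simp [growthArray]

theorem sum_eq_sum_diagonals {N : ℕ} {f : ℕ → ℕ → ℕ} (hf : SupportedIn N N f) :
    ∑ r ∈ Finset.range N, ∑ s ∈ Finset.range N, f r s =
      ∑ d ∈ Finset.range N, ∑ k ∈ Finset.range N, f (k + d) k +
        ∑ d ∈ Finset.range N, ∑ k ∈ Finset.range N, f k (k + (d + 1)) := by
  simp only [← Finset.sum_product']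
  rw [← Finset.sum_filter_add_sum_filter_not _ (fun p : ℕ × ℕ => p.2 ≤ p.1)]
  congr 1
  -- Only nonzero terms are matched: pairs `(d, k)` with `k + d ≥ N` leave the square, where `f`
  -- vanishes.
  · refine Finset.sum_bij_ne_zero (fun p _ _ => (p.1 - p.2, p.2)) ?_ ?_ ?_ ?_
    · rintro ⟨r, s⟩ h _
      simp only [Finset.mem_filter, Finset.mem_product, Finset.mem_range] at h ⊢
      omega
    · rintro ⟨r, s⟩ h _ ⟨r', s'⟩ h' _ heq
      simp only [Finset.mem_filter, Finset.mem_product, Finset.mem_range, Prod.mk.injEq] at *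
      omega
    · rintro ⟨d, k⟩ h h0
      simp only [Finset.mem_product, Finset.mem_range] at h
      have hlt : k + d < N := by
        by_contra hc
        exact h0 (hf _ _ (by omega))
      exact ⟨(k + d, k), by simp; omega, h0, by simp⟩
    · rintro ⟨r, s⟩ h _
      simp only [Finset.mem_filter] at h
      simp only [Nat.add_sub_cancel' h.2]
  · refine Finset.sum_bij_ne_zero (fun p _ _ => (p.2 - p.1 - 1, p.1)) ?_ ?_ ?_ ?_
    · rintro ⟨r, s⟩ h _
      simp only [Finset.mem_filter, Finset.mem_product, Finset.mem_range] at h ⊢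
      omega
    · rintro ⟨r, s⟩ h _ ⟨r', s'⟩ h' _ heq
      simp only [Finset.mem_filter, Finset.mem_product, Finset.mem_range, Prod.mk.injEq] at *
      omega
    · rintro ⟨d, k⟩ h h0
      simp only [Finset.mem_product, Finset.mem_range] at h
      have hlt : k + (d + 1) < N := by
        by_contra hc
        exact h0 (hf _ _ (by omega))
      refine ⟨(k, k + (d + 1)), by simp; omega, h0, ?_⟩
      simp only [Prod.mk.injEq, and_true]
      omega
    · rintro ⟨r, s⟩ h _
      simp only [Finset.mem_filter] at h
      simp only
      rw [show r + (s - r - 1 + 1) = s by omega]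

theorem sum_range_ite_lt (n N c : ℕ) (h : n ≤ N) (P : ℕ → Prop) [DecidablePred P]
    (hP : ∀ d, P d ↔ d < n) : ∑ d ∈ Finset.range N, (if P d then c else 0) = c * n := by
  simp only [hP]
  rw [← Finset.sum_filter, Finset.sum_const, smul_eq_mul, mul_comm,
    show (Finset.range N).filter (· < n) = Finset.range n by ext d; simp; omega,
    Finset.card_range]

/-- The entry `x a b` contributes to `n₁ - a` diagonals on or below the main one and to `n₂ - b - 1`
strictly above it. -/
theorem volume_growthArray (n₁ n₂ : ℕ) (x : ℕ → ℕ → ℕ) :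
    ∑ r ∈ Finset.range (n₁ + n₂), ∑ s ∈ Finset.range (n₁ + n₂), growthArray n₁ n₂ x r s =
      ∑ a ∈ Finset.range n₁, ∑ b ∈ Finset.range n₂, x a b * ((n₁ - a) + (n₂ - b) - 1) := by
  have hsub : ∀ m n (f : ℕ → ℕ), m ≤ n → ∑ a ∈ Finset.range m, f a =
      ∑ a ∈ Finset.range n, if a < m then f a else 0 := by
    intro m n f h
    rw [← Finset.sum_filter]
    congr 1
    ext a
    simp
    omega
  rw [sum_eq_sum_diagonals (fun r s h => growthArray_supportedIn n₁ n₂ x r s (by omega))]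
  -- Writing the subrectangle as an indicator over the full rectangle allows the sum over `d` to be
  -- taken innermost.
  have h1 : ∀ d, ∑ k ∈ Finset.range (n₁ + n₂), growthArray n₁ n₂ x (k + d) k =
      ∑ a ∈ Finset.range n₁, ∑ b ∈ Finset.range n₂, if a < n₁ - d then x a b else 0 := by
    intro d
    simp only [Finset.sum_ite_irrel, Finset.sum_const_zero]
    rw [← hsub _ _ _ (Nat.sub_le _ _), ← sum_growth x (n₁ - d) n₂ (n₁ + n₂) (by omega)]
    simp [growthArray]
  have h2 : ∀ d, ∑ k ∈ Finset.range (n₁ + n₂), growthArray n₁ n₂ x k (k + (d + 1)) =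
      ∑ a ∈ Finset.range n₁, ∑ b ∈ Finset.range n₂, if b < n₂ - (d + 1) then x a b else 0 := by
    intro d
    simp only [← hsub _ _ _ (Nat.sub_le n₂ (d + 1))]
    rw [← sum_growth x n₁ (n₂ - (d + 1)) (n₁ + n₂) (by omega)]
    simp [growthArray]
  simp only [h1, h2]
  rw [Finset.sum_comm, Finset.sum_comm (s := Finset.range (n₁ + n₂)), ← Finset.sum_add_distrib]
  refine Finset.sum_congr rfl fun a ha => ?_
  rw [Finset.sum_comm, Finset.sum_comm (s := Finset.range (n₁ + n₂)), ← Finset.sum_add_distrib]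
  refine Finset.sum_congr rfl fun b hb => ?_
  rw [Finset.mem_range] at ha hb
  rw [sum_range_ite_lt (n₁ - a) _ _ (by omega) _ (by omega),
    sum_range_ite_lt (n₂ - b - 1) _ _ (by omega) _ (by omega), ← mul_add]
  congr 1
  omega

/-! ### Last passage percolation -/

/-- The array of last passage times of the matrix `x`, which are the first rows of its growth
diagram. -/
def passageArray (n₁ n₂ : ℕ) (x : ℕ → ℕ → ℕ) (r s : ℕ) : ℕ := growth x (n₁ - r) (n₂ - s) 0

/-- The number of corners of an array above the cell `(r, s)`. -/
def cornerCount (e : ℕ → ℕ → ℕ) (r s : ℕ) : ℕ := e r s - max (e (r + 1) s) (e r (s + 1))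

/-- The inverse of `passageArray`. -/
def cornerMatrix (n₁ n₂ : ℕ) (e : ℕ → ℕ → ℕ) (i j : ℕ) : ℕ :=
  if i < n₁ ∧ j < n₂ then cornerCount e (n₁ - 1 - i) (n₂ - 1 - j) else 0

theorem cornerMatrix_supportedIn (n₁ n₂ : ℕ) (e : ℕ → ℕ → ℕ) :
    SupportedIn n₁ n₂ (cornerMatrix n₁ n₂ e) := fun _ _ h => if_neg (by omega)

theorem passageArray_supportedIn (n₁ n₂ : ℕ) (x : ℕ → ℕ → ℕ) :
    SupportedIn n₁ n₂ (passageArray n₁ n₂ x) := fun r s h =>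
  growth_eq_zero _ _ _ _ (by omega)

theorem passageArray_decreasing (n₁ n₂ : ℕ) (x : ℕ → ℕ → ℕ) :
    Decreasing (passageArray n₁ n₂ x) := by
  intro r s
  unfold passageArray
  rw [← Nat.sub_sub, ← Nat.sub_sub]
  constructor
  · cases n₁ - r with
    | zero => simp
    | succ i => exact ((interlace_growth x i _).2 0).1
  · cases n₂ - s with
    | zero => simp
    | succ j => exact ((interlace_growth x _ j).1 0).1

/-- The zeroth component of the growth rule involves neither `μ` nor the later components, so it is
a closed recursion; monotonicity of `e` makes the subtraction in `cornerCount` exact. -/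
theorem growth_cornerMatrix {n₁ n₂ : ℕ} {e : ℕ → ℕ → ℕ} (he : Decreasing e)
    (hs : SupportedIn n₁ n₂ e) (i j : ℕ) (hi : i ≤ n₁) (hj : j ≤ n₂) :
    growth (cornerMatrix n₁ n₂ e) i j 0 = e (n₁ - i) (n₂ - j) := by
  induction i generalizing j with
  | zero => rw [growth_zero_left, hs _ _ (by omega)]
  | succ i ihi =>
    induction j with
    | zero => rw [growth_zero_right, hs _ _ (by omega)]
    | succ j ihj =>
      obtain ⟨a, rfl⟩ := Nat.exists_eq_add_of_le hi
      obtain ⟨b, rfl⟩ := Nat.exists_eq_add_of_le hj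
      have h1 : i + 1 + a - i = a + 1 := by omega
      have h2 : j + 1 + b - j = b + 1 := by omega
      have h3 : i + 1 + a - 1 - i = a := by omega
      have h4 : j + 1 + b - 1 - j = b := by omega
      have h5 := ihi (j + 1) (by omega) hj
      have h6 := ihj (by omega)
      rw [h1, Nat.add_sub_cancel_left] at h5
      rw [h2, Nat.add_sub_cancel_left] at h6
      have h7 := he a b
      rw [growth_succ_succ, growUp, h5, h6, cornerMatrix, if_pos (by omega), h3, h4,
        Nat.add_sub_cancel_left, Nat.add_sub_cancel_left, cornerCount]
      omega

theorem passageArray_cornerMatrix {n₁ n₂ : ℕ} {e : ℕ → ℕ → ℕ} (he : Decreasing e)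
    (hs : SupportedIn n₁ n₂ e) : passageArray n₁ n₂ (cornerMatrix n₁ n₂ e) = e := by
  funext r s
  rw [passageArray, growth_cornerMatrix he hs _ _ (Nat.sub_le _ _) (Nat.sub_le _ _)]
  by_cases h : r ≤ n₁ ∧ s ≤ n₂
  · rw [Nat.sub_sub_self h.1, Nat.sub_sub_self h.2]
  · rw [hs _ _ (by omega), hs r s (by omega)]

theorem cornerMatrix_passageArray {n₁ n₂ : ℕ} {x : ℕ → ℕ → ℕ} (hx : SupportedIn n₁ n₂ x) :
    cornerMatrix n₁ n₂ (passageArray n₁ n₂ x) = x := by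
  funext i j
  unfold cornerMatrix
  split_ifs with h
  · simp only [cornerCount, passageArray]
    rw [show n₁ - (n₁ - 1 - i) = i + 1 by omega, show n₂ - (n₂ - 1 - j) = j + 1 by omega,
      show n₁ - (n₁ - 1 - i + 1) = i by omega, show n₂ - (n₂ - 1 - j + 1) = j by omega,
      growth_succ_succ, growUp]
    omega
  · exact (hx i j (by omega)).symm

theorem sum_cornerMatrix_mul (n₁ n₂ : ℕ) (e w : ℕ → ℕ → ℕ) :
    ∑ a ∈ Finset.range n₁, ∑ b ∈ Finset.range n₂,
        cornerMatrix n₁ n₂ e a b * w (n₁ - 1 - a) (n₂ - 1 - b) =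
      ∑ r ∈ Finset.range n₁, ∑ s ∈ Finset.range n₂, cornerCount e r s * w r s := by
  rw [← Finset.sum_range_reflect _ n₁]
  refine Finset.sum_congr rfl fun a ha => ?_
  rw [← Finset.sum_range_reflect _ n₂]
  refine Finset.sum_congr rfl fun b hb => ?_
  rw [Finset.mem_range] at ha hb
  rw [cornerMatrix, if_pos (by omega), Nat.sub_sub_self (by omega), Nat.sub_sub_self (by omega)]

/-! ### The two bijections. -/

/-- Arrays that are weakly decreasing and vanish outside `[0, n₁) × [0, n₂)`. -/
abbrev BoxedArray (n₁ n₂ : ℕ) := {e : ℕ → ℕ → ℕ // Decreasing e ∧ SupportedIn n₁ n₂ e}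

/-- The Robinson–Schensted–Knuth correspondence from matrices to boxed arrays. -/
def growthEquiv (n₁ n₂ : ℕ) : {x // SupportedIn n₁ n₂ x} ≃ BoxedArray n₁ n₂ where
  toFun x := ⟨growthArray n₁ n₂ x, growthArray_decreasing n₁ n₂ x, growthArray_supportedIn n₁ n₂ x⟩
  invFun e := ⟨shrinkMatrix n₁ n₂ e, shrinkMatrix_supportedIn n₁ n₂ e⟩
  left_inv x := Subtype.ext (shrinkMatrix_growthArray x.2)
  right_inv e := Subtype.ext (growthArray_shrinkMatrix e.2.1 e.2.2)

/-- The correspondence from boxed arrays to matrices that counts the corners above each cell. -/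
def cornerEquiv (n₁ n₂ : ℕ) : BoxedArray n₁ n₂ ≃ {x // SupportedIn n₁ n₂ x} where
  toFun e := ⟨cornerMatrix n₁ n₂ e, cornerMatrix_supportedIn n₁ n₂ e⟩
  invFun x := ⟨passageArray n₁ n₂ x, passageArray_decreasing n₁ n₂ x,
    passageArray_supportedIn n₁ n₂ x⟩
  left_inv e := Subtype.ext (passageArray_cornerMatrix e.2.1 e.2.2)
  right_inv x := Subtype.ext (cornerMatrix_passageArray x.2)

theorem Decreasing.le {e : ℕ → ℕ → ℕ} (he : Decreasing e) {r r' s s' : ℕ} (hr : r ≤ r')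
    (hs : s ≤ s') : e r' s' ≤ e r s :=
  (antitone_nat_of_succ_le (f := fun r => e r s') (fun r => (he r s').1) hr).trans
    (antitone_nat_of_succ_le (f := e r) (fun s => (he r s).2) hs)

namespace PlanePartition

/-! ### Plane partitions as arrays -/

/-- The entries of a plane partition, indexed from `0`. -/
def toArray (π : PlanePartition) (r s : ℕ) : ℕ := π.entry (r.succPNat, s.succPNat)

theorem entry_eq_toArray (π : PlanePartition) (p : ℕ+ × ℕ+) :
    π.entry p = π.toArray p.1.natPred p.2.natPred := by
  simp [toArray]

theorem toArray_decreasing (π : PlanePartition) : Decreasing π.toArray := fun _ _ =>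
  ⟨π.antitone_entry ⟨Nat.succPNat_le_succPNat.2 (Nat.le_succ _), le_rfl⟩,
    π.antitone_entry ⟨le_rfl, Nat.succPNat_le_succPNat.2 (Nat.le_succ _)⟩⟩

theorem mem_boxed_iff {n₁ n₂ : ℕ} {π : PlanePartition} :
    π ∈ boxed n₁ n₂ ↔ SupportedIn n₁ n₂ π.toArray := by
  constructor
  · intro h r s hrs
    by_contra h0
    have h1 := h (r.succPNat, s.succPNat, 1) (Nat.one_le_iff_ne_zero.2 h0)
    simp only [Nat.succPNat_coe] at h1
    omega
  · rintro h ⟨i, j, k⟩ hc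
    have hc' : (k : ℕ) ≤ π.entry (i, j) := hc
    rw [entry_eq_toArray] at hc'
    by_contra h0
    have h1 := h i.natPred j.natPred (by
      have hi := PNat.natPred_add_one i
      have hj := PNat.natPred_add_one j
      simp only at h0
      omega)
    have := k.pos
    simp only at hc'
    omega

/-- The plane partition with a given array of entries. -/
def ofArray {n₁ n₂ : ℕ} (e : BoxedArray n₁ n₂) : PlanePartition where
  entry p := e.1 p.1.natPred p.2.natPred
  finite_support := by
    refine ((Set.finite_Iio n₁).prod (Set.finite_Iio n₂)).preimage
      (f := fun p : ℕ+ × ℕ+ => (p.1.natPred, p.2.natPred)) ?_ |>.subset ?_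
    · rintro ⟨i, j⟩ _ ⟨i', j'⟩ _ h
      simpa using h
    · intro p hp
      by_contra h
      refine hp (e.2.2 _ _ ?_)
      simp only [Set.mem_preimage, Set.mem_prod, Set.mem_Iio] at h
      omega
  antitone_entry _ _ h := e.2.1.le (PNat.natPred_le_natPred.2 h.1) (PNat.natPred_le_natPred.2 h.2)

theorem toArray_ofArray {n₁ n₂ : ℕ} (e : BoxedArray n₁ n₂) : (ofArray e).toArray = e := by
  funext r s
  simp [toArray, ofArray]

/-- Boxed plane partitions are boxed arrays. -/
def boxedEquiv (n₁ n₂ : ℕ) : boxed n₁ n₂ ≃ BoxedArray n₁ n₂ where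
  toFun π := ⟨π.1.toArray, π.1.toArray_decreasing, mem_boxed_iff.1 π.2⟩
  invFun e := ⟨ofArray e, mem_boxed_iff.2 (by rw [toArray_ofArray]; exact e.2.2)⟩
  left_inv π := by
    ext p
    simp [ofArray, toArray]
  right_inv e := Subtype.ext (toArray_ofArray e)

/-! ### The statistics as finite sums over arrays. -/

theorem trace_eq {N : ℕ} {π : PlanePartition} (h : SupportedIn N N π.toArray) :
    π.trace = ∑ k ∈ Finset.range N, π.toArray k k := by
  rw [trace, finsum_eq_sum_of_support_subset (s := (Finset.range N).image Nat.succPNat),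
    Finset.sum_image Nat.succPNat_injective.injOn]
  · rfl
  · intro i hi
    refine Finset.mem_coe.2 (Finset.mem_image.2 ⟨i.natPred, ?_, by simp⟩)
    by_contra hN
    rw [Finset.mem_range, not_lt] at hN
    rw [Function.mem_support, entry_eq_toArray] at hi
    exact hi (h _ _ (Or.inl hN))

theorem volume_eq {N : ℕ} {π : PlanePartition} (h : SupportedIn N N π.toArray) :
    π.volume = ∑ r ∈ Finset.range N, ∑ s ∈ Finset.range N, π.toArray r s := by
  rw [volume, ← Finset.sum_product']
  refine Finset.sum_bij_ne_zero (fun p _ _ => (p.1.natPred, p.2.natPred)) ?_ ?_ ?_ ?_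
  · intro p _ hp
    by_contra h0
    rw [entry_eq_toArray] at hp
    simp only [Finset.mem_product, Finset.mem_range] at h0
    exact hp (h _ _ (by omega))
  · rintro ⟨i, j⟩ _ _ ⟨i', j'⟩ _ _ heq
    simpa using heq
  · rintro ⟨r, s⟩ _ h0
    exact ⟨(r.succPNat, s.succPNat), π.finite_support.mem_toFinset.2 h0, h0, by simp⟩
  · exact fun p _ _ => π.entry_eq_toArray p

theorem sum_Cor {n₁ n₂ : ℕ} {π : PlanePartition} (h : SupportedIn n₁ n₂ π.toArray)
    (w : ℕ → ℕ → ℕ) :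
    ∑ c ∈ π.finite_Cor.toFinset, w c.1.natPred c.2.1.natPred =
      ∑ r ∈ Finset.range n₁, ∑ s ∈ Finset.range n₂, cornerCount π.toArray r s * w r s := by
  rw [← Finset.sum_product', ← Finset.sum_fiberwise_of_maps_to
    (g := fun c : ℕ+ × ℕ+ × ℕ+ => (c.1.natPred, c.2.1.natPred))
    (t := Finset.range n₁ ×ˢ Finset.range n₂)]
  · refine Finset.sum_congr rfl ?_
    rintro ⟨r, s⟩ _
    have hmem : ∀ c : ℕ+ × ℕ+ × ℕ+,
        c ∈ π.finite_Cor.toFinset.filter (fun c => (c.1.natPred, c.2.1.natPred) = (r, s)) ↔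
          c.1 = r.succPNat ∧ c.2.1 = s.succPNat ∧ (c.2.2 : ℕ) ≤ π.toArray r s ∧
            π.toArray (r + 1) s < c.2.2 ∧ π.toArray r (s + 1) < c.2.2 := by
      rintro ⟨i, j, k⟩
      obtain ⟨i, rfl⟩ := Equiv.pnatEquivNat.symm.surjective i
      obtain ⟨j, rfl⟩ := Equiv.pnatEquivNat.symm.surjective j
      have hi : i.succPNat + 1 = (i + 1).succPNat := rfl
      have hj : j.succPNat + 1 = (j + 1).succPNat := rfl
      simp only [Equiv.pnatEquivNat_symm_apply, Finset.mem_filter, Set.Finite.mem_toFinset, Cor,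
        diagram, Set.mem_ofPred_eq, hi, hj, Nat.natPred_succPNat, Prod.mk.injEq,
        Nat.succPNat_inj, not_le, toArray]
      constructor
      · rintro ⟨h1, rfl, rfl⟩
        exact ⟨rfl, rfl, h1⟩
      · rintro ⟨rfl, rfl, h1⟩
        exact ⟨h1, rfl, rfl⟩
    rw [Finset.sum_congr rfl (g := fun _ => w r s), Finset.sum_const, smul_eq_mul]
    · congr 1
      -- The corners above a cell occupy the heights exceeding both neighbouring entries, up to the
      -- entry itself.
      rw [cornerCount, ← Nat.card_Ioc]
      refine Finset.card_nbij' (fun c => (c.2.2 : ℕ))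
        (fun k => (r.succPNat, s.succPNat, k.toPNat')) ?_ ?_ ?_ ?_
      · intro c hc
        have := (hmem c).1 hc
        simp only [Finset.coe_Ioc, Set.mem_Ioc]
        omega
      · intro k hk
        simp only [Finset.coe_Ioc, Set.mem_Ioc] at hk
        refine (hmem _).2 ⟨rfl, rfl, ?_⟩
        rw [Nat.toPNat'_coe, if_pos (by omega)]
        omega
      · intro c hc
        obtain ⟨h1, h2, -⟩ := (hmem c).1 hc
        simp [← h1, ← h2]
      · intro k hk
        simp only [Finset.coe_Ioc, Set.mem_Ioc] at hk
        simp only [Nat.toPNat'_coe]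
        rw [if_pos (by omega)]
    · intro c hc
      have := (Finset.mem_filter.1 hc).2
      rw [Prod.mk.injEq] at this
      rw [this.1, this.2]
  · rintro ⟨i, j, k⟩ hc
    have hc' : (i, j, k) ∈ π.diagram := ((Set.Finite.mem_toFinset _).1 hc).1
    have h1 := mem_boxed_iff.2 h _ hc'
    have hi := PNat.natPred_add_one i
    have hj := PNat.natPred_add_one j
    simp only [Finset.mem_product, Finset.mem_range] at h1 ⊢
    omega

/-! ### Transport of the statistics, and finiteness. -/

/-- The bijection of boxed plane partitions that takes the corner statistics to the trace and
volume. -/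
def cornerToTrace (n₁ n₂ : ℕ) : boxed n₁ n₂ ≃ boxed n₁ n₂ :=
  (boxedEquiv n₁ n₂).trans
    ((cornerEquiv n₁ n₂).trans ((growthEquiv n₁ n₂).trans (boxedEquiv n₁ n₂).symm))

theorem toArray_cornerToTrace {n₁ n₂ : ℕ} (π : boxed n₁ n₂) :
    (cornerToTrace n₁ n₂ π).1.toArray =
      growthArray n₁ n₂ (cornerMatrix n₁ n₂ π.1.toArray) :=
  toArray_ofArray _

theorem trace_cornerToTrace {n₁ n₂ : ℕ} (π : boxed n₁ n₂) :
    (cornerToTrace n₁ n₂ π).1.trace = π.1.cor := by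
  have h1 := sum_Cor (mem_boxed_iff.1 π.2) (fun _ _ => 1)
  rw [← sum_cornerMatrix_mul] at h1
  have h2 := mem_boxed_iff.1 (cornerToTrace n₁ n₂ π).2
  rw [trace_eq (N := n₁ + n₂) (fun r s h => h2 r s (by omega)), toArray_cornerToTrace,
    trace_growthArray n₁ n₂ _ (Nat.le_add_right _ _), cor,
    Set.ncard_eq_toFinset_card _ π.1.finite_Cor]
  simpa using h1.symm

theorem volume_cornerToTrace {n₁ n₂ : ℕ} (π : boxed n₁ n₂) :
    (cornerToTrace n₁ n₂ π).1.volume = π.1.cornerHookVolume := by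
  have h1 := sum_Cor (mem_boxed_iff.1 π.2) (fun r s => (r + 1) + (s + 1) - 1)
  rw [← sum_cornerMatrix_mul] at h1
  have h2 := mem_boxed_iff.1 (cornerToTrace n₁ n₂ π).2
  rw [volume_eq (N := n₁ + n₂) (fun r s h => h2 r s (by omega)), toArray_cornerToTrace,
    volume_growthArray, cornerHookVolume]
  simp only [PNat.natPred_add_one] at h1
  rw [h1]
  refine Finset.sum_congr rfl fun a ha => Finset.sum_congr rfl fun b hb => ?_
  rw [Finset.mem_range] at ha hb
  congr 1
  omega

theorem finite_volume_eq (n₁ n₂ b : ℕ) : {π ∈ boxed n₁ n₂ | π.volume = b}.Finite := by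
  have hle : ∀ π : PlanePartition, ∀ p, π.entry p ≤ π.volume := by
    intro π p
    by_cases hp : p ∈ π.finite_support.toFinset
    · exact Finset.single_le_sum (f := π.entry) (fun _ _ => Nat.zero_le _) hp
    · simp only [Set.Finite.mem_toFinset, Function.mem_support, not_not] at hp
      omega
  -- Every entry is at most the volume `b`, so reduction modulo `b + 1` loses nothing and the
  -- partition is determined by finitely many residues.
  refine Set.Finite.of_injOn (t := Set.univ)
    (f := fun π (p : Fin n₁ × Fin n₂) => Fin.ofNat (b + 1) (π.toArray p.1 p.2))
    (fun _ _ => Set.mem_univ _) ?_ Set.finite_univ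
  rintro π ⟨hπ, hb⟩ π' ⟨hπ', hb'⟩ heq
  rw [mem_boxed_iff] at hπ hπ'
  have key : π.toArray = π'.toArray := by
    funext r s
    by_cases h : r < n₁ ∧ s < n₂
    · have h1 := congrArg Fin.val (congrFun heq (⟨r, h.1⟩, ⟨s, h.2⟩))
      have h2 := hle π (r.succPNat, s.succPNat)
      have h3 := hle π' (r.succPNat, s.succPNat)
      simp only [Fin.ofNat] at h1
      change π.toArray r s ≤ _ at h2
      change π'.toArray r s ≤ _ at h3
      rwa [Nat.mod_eq_of_lt (by omega), Nat.mod_eq_of_lt (by omega)] at h1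
    · rw [hπ r s (by omega), hπ' r s (by omega)]
  ext p
  rw [entry_eq_toArray, entry_eq_toArray, key]

end PlanePartition

/-! ### Passage to formal power series. -/

theorem coeff_tqMonomial (a b : ℕ) (m : Fin 2 →₀ ℕ) :
    MvPowerSeries.coeff m (tqMonomial a b) = if m 0 = a ∧ m 1 = b then 1 else 0 := by
  rw [tqMonomial, MvPowerSeries.X_pow_eq, MvPowerSeries.X_pow_eq,
    MvPowerSeries.monomial_mul_monomial, mul_one, MvPowerSeries.coeff_monomial]
  congr 1
  simp [Finsupp.ext_iff, Fin.forall_fin_two]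

theorem summable_tqMonomial {ι : Type*} (A B : ι → ℕ)
    (h : ∀ a b, {i | A i = a ∧ B i = b}.Finite) :
    Summable (fun i => tqMonomial (A i) (B i)) := by
  -- Convergence is coefficientwise, and each coefficient receives only finitely many nonzero terms.
  refine Pi.summable.2 fun m => ?_
  refine summable_of_hasFiniteSupport ((h (m 0) (m 1)).subset fun i hi => ?_)
  by_contra hne
  refine hi ((coeff_tqMonomial _ _ m).trans (if_neg fun hm => hne ⟨hm.1.symm, hm.2.symm⟩))

open PlanePartition in
theorem finite_trace_volume (n₁ n₂ a b : ℕ) :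
    {π ∈ boxed n₁ n₂ | π.trace = a ∧ π.volume = b}.Finite :=
  (finite_volume_eq n₁ n₂ b).subset fun _ h => ⟨h.1, h.2.2⟩

theorem mainTheorem9 (n₁ n₂ : ℕ) :
    -- the generating functions of the two pairs of statistics are well defined and equal
    (Summable (fun π : PlanePartition.boxed n₁ n₂ =>
        tqMonomial π.1.cor π.1.cornerHookVolume) ∧
      Summable (fun π : PlanePartition.boxed n₁ n₂ =>
        tqMonomial π.1.trace π.1.volume) ∧
      ∑' π : PlanePartition.boxed n₁ n₂, tqMonomial π.1.cor π.1.cornerHookVolume =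
        ∑' π : PlanePartition.boxed n₁ n₂, tqMonomial π.1.trace π.1.volume) ∧
    -- equivalently, the two joint distributions are finite and agree
    ∀ a b : ℕ,
      {π ∈ PlanePartition.boxed n₁ n₂ | π.cor = a ∧ π.cornerHookVolume = b}.Finite ∧
      {π ∈ PlanePartition.boxed n₁ n₂ | π.trace = a ∧ π.volume = b}.Finite ∧
      {π ∈ PlanePartition.boxed n₁ n₂ | π.cor = a ∧ π.cornerHookVolume = b}.ncard =
        {π ∈ PlanePartition.boxed n₁ n₂ | π.trace = a ∧ π.volume = b}.ncard := by
  have hstat : (fun π : PlanePartition.boxed n₁ n₂ => tqMonomial π.1.cor π.1.cornerHookVolume) =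
      (fun π : PlanePartition.boxed n₁ n₂ => tqMonomial π.1.trace π.1.volume) ∘
        PlanePartition.cornerToTrace n₁ n₂ := by
    funext π
    simp only [Function.comp_apply, PlanePartition.trace_cornerToTrace,
      PlanePartition.volume_cornerToTrace]
  have hsum : Summable (fun π : PlanePartition.boxed n₁ n₂ =>
      tqMonomial π.1.trace π.1.volume) := by
    refine summable_tqMonomial _ _ fun a b => ?_
    refine ((finite_trace_volume n₁ n₂ a b).preimage Subtype.val_injective.injOn).subset ?_
    exact fun π h => ⟨π.2, h⟩
  refine ⟨⟨?_, hsum, ?_⟩, fun a b => ?_⟩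
  · rw [hstat]
    exact (Equiv.summable_iff _).2 hsum
  · rw [hstat]
    exact Equiv.tsum_eq (PlanePartition.cornerToTrace n₁ n₂)
      (fun π : PlanePartition.boxed n₁ n₂ => tqMonomial π.1.trace π.1.volume)
  · have e : {π ∈ PlanePartition.boxed n₁ n₂ | π.cor = a ∧ π.cornerHookVolume = b} ≃
        {π ∈ PlanePartition.boxed n₁ n₂ | π.trace = a ∧ π.volume = b} :=
      (Equiv.subtypeSubtypeEquivSubtypeInter (· ∈ PlanePartition.boxed n₁ n₂)
        (fun π => π.cor = a ∧ π.cornerHookVolume = b)).symm.trans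
      (((PlanePartition.cornerToTrace n₁ n₂).subtypeEquiv fun π => by
        rw [PlanePartition.trace_cornerToTrace, PlanePartition.volume_cornerToTrace]).trans
      (Equiv.subtypeSubtypeEquivSubtypeInter (· ∈ PlanePartition.boxed n₁ n₂)
        (fun π => π.trace = a ∧ π.volume = b)))
    have hfin := finite_trace_volume n₁ n₂ a b
    exact ⟨Set.finite_coe_iff.1 (e.finite_iff.2 hfin), hfin, Nat.card_congr e⟩
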